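/- Let $\boldsymbol W:\mathbb R\to\mathbb C^{N\times N}$ be a weight such that $\boldsymbol W(x)$ is Hermitian positive definite for every $x\in\mathbb R$ and all moments are finite, i.e. $x^kW_{ij}(x)$ is integrable on $\mathbb R$ for all $k\ge 0$ and all $i,j$. Assume that $\boldsymbol W(x)=\boldsymbol T(x)\boldsymbol T(x)^*$ and $\boldsymbol T'(x)=\boldsymbol G(x)\boldsymbol T(x)$ for all $x\in\mathbb R$, where $\boldsymbol T:\mathbb R\to\mathbb C^{N\times N}$ is differentiable and $\boldsymbol G(z)=\sum_{j=0}^m \boldsymbol M_jz^j$ is a matrix polynomial of degree at most $m$. Matrix-valued integrals are taken entrywise, and for a matrix function of a complex variable $\boldsymbol F^*(z):=(\boldsymbol F(\bar z))^*$. Then there is a unique sequence $(\widehat{\boldsymbol P}_n)_{n\ge 0}$ of matrix polynomials, $\widehat{\boldsymbol P}_n(x)=x^n\boldsymbol I+\sum_{j=0}^{n-1}\boldsymbol a_{n,j}x^j$, with $\int_{\mathbb R}\widehat{\boldsymbol P}_n\boldsymbol W\boldsymbol Q^*\,dx=\boldsymbol 0$ for every matrix polynomial $\boldsymbol Q$ of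 degree less than $n$; and there are matrices $\boldsymbol\kappa_n$ such that the polynomials $\boldsymbol\kappa_n\widehat{\boldsymbol P}_n$ are orthonormal, $\int_{\mathbb R}\boldsymbol\kappa_n\widehat{\boldsymbol P}_n\boldsymbol W(\boldsymbol\kappa_k\widehat{\boldsymbol P}_k)^*dx=\delta_{n,k}\boldsymbol I$. For any such $\boldsymbol\kappa_n$ put $\boldsymbol\gamma_n=\boldsymbol\kappa_n^*\boldsymbol\kappa_n$, $\boldsymbol\alpha_n=\boldsymbol a_{n,n-1}-\boldsymbol a_{n+1,n}$, $\boldsymbol\beta_n=\boldsymbol\gamma_n^{-1}\boldsymbol\gamma_{n-1}$ for $n\ge1$ and $\boldsymbol\beta_0=\boldsymbol 0$. Put $\boldsymbol a_{n,n}=\boldsymbol I$, $\boldsymbol a_{n,j}=\boldsymbol 0$ for $j<0$, $$\boldsymbol b_{n,k}=\int_{\mathbb R}x^k\widehat{\boldsymbol P}_n(x)\boldsymbol W(x)\,dx\quad(k\ge n),\qquad \boldsymbol b_{n,k}=\boldsymbol 0\quad(k<n),$$ $$\widehat{\boldsymbol P}_{n,k}(z)=\sum_{i=0}^k\boldsymbol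 a_{n,n-i}z^{k-i},\qquad \boldsymbol\Delta_{j,n}(z)=\sum_{k=0}^j\widehat{\boldsymbol P}_{n,k}(z)\boldsymbol M_{m-j+k}\quad(0\le j\le m),$$ $$\mathcal A_n(z)=-\boldsymbol\gamma_n\sum_{j=0}^{m-1}\Big(\boldsymbol b_{n,n+m-j-1}\boldsymbol\Delta_{j,n}^*(z)+\boldsymbol\Delta_{j,n}(z)\boldsymbol b_{n,n+m-j-1}^*\Big)\qquad(n\ge 0),$$ $$\mathcal B_n(z)=-\sum_{j=0}^{m}\Big(\boldsymbol\Delta_{j,n}(z)\boldsymbol b_{n-1,n+m-j-1}^*+\boldsymbol b_{n,n+m-j-2}\boldsymbol\Delta_{j,n-1}^*(z)\Big)\boldsymbol\gamma_{n-1}\quad(n\ge1),\qquad \mathcal B_0(z)=-\boldsymbol\Delta_{m,0}(z)=-\boldsymbol G(z).$$ Then for every $n\ge 0$ and $z\in\mathbb C$ (terms with $\boldsymbol\beta_0$ being absent for $n=0$) the three-term recurrence $$z\widehat{\boldsymbol P}_n(z)=\widehat{\boldsymbol P}_{n+1}(z)+\boldsymbol\alpha_n\widehat{\boldsymbol P}_n(z)+\boldsymbol\beta_n\widehat{\boldsymbol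 P}_{n-1}(z)$$ holds, together with the lowering relation $$\widehat{\boldsymbol P}_n'(z)+\widehat{\boldsymbol P}_n(z)\boldsymbol G(z)=-\mathcal B_n(z)\widehat{\boldsymbol P}_n(z)+\mathcal A_n^*(z)\boldsymbol\beta_n\widehat{\boldsymbol P}_{n-1}(z)$$ and the raising relation $$\widehat{\boldsymbol P}_n'(z)+\widehat{\boldsymbol P}_n(z)\boldsymbol G(z)=\big(\mathcal A_n^*(z)(z\boldsymbol I-\boldsymbol\alpha_n)-\mathcal B_n(z)\big)\widehat{\boldsymbol P}_n(z)-\mathcal A_n^*(z)\widehat{\boldsymbol P}_{n+1}(z).$$ -/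

import Mathlib

open Polynomial MeasureTheory
open scoped ComplexOrder

/-- Complex `N × N` matrices. -/
abbrev CMat (N : ℕ) : Type := Matrix (Fin N) (Fin N) ℂ

/-- Value `∑ₖ zᵏ Aₖ` of the matrix polynomial `P = ∑ₖ Aₖ Xᵏ` at the scalar `z`. -/
noncomputable def matEval {N : ℕ} (P : (CMat N)[X]) (z : ℂ) : CMat N :=
  P.eval (Matrix.scalar (Fin N) z)

/-- For a matrix function `F` of a complex variable, `F*(z) = (F(z̄))*`. -/
noncomputable def matStar {N : ℕ} (F : ℂ → CMat N) (z : ℂ) : CMat N :=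
  (F (starRingEnd ℂ z)).conjTranspose

/-- Entrywise integral over `ℝ` of a matrix function. -/
noncomputable def matIntegral {N : ℕ} (F : ℝ → CMat N) : CMat N :=
  Matrix.of fun i j => ∫ x : ℝ, F x i j

/-- The matrix-valued inner product `(P, Q)_W = ∫ P(x) W(x) Q*(x) dx`. -/
noncomputable def innerW {N : ℕ} (W : ℝ → CMat N) (P Q : (CMat N)[X]) : CMat N :=
  matIntegral fun x => matEval P (x : ℂ) * W x * (matEval Q (x : ℂ)).conjTranspose

/-- `P` is the sequence of monic matrix orthogonal polynomials of `W`: `P n` is monic of degree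
`n`, and `(P n, Q)_W = 0` for every matrix polynomial `Q` of degree less than `n`. -/
def IsMonicMOPRL {N : ℕ} (W : ℝ → CMat N) (P : ℕ → (CMat N)[X]) : Prop :=
  ∀ n : ℕ, (P n).natDegree ≤ n ∧ (P n).coeff n = 1 ∧
    ∀ Q : (CMat N)[X], Q.degree < (n : WithBot ℕ) → innerW W (P n) Q = 0

/-- `κ n` are the leading coefficients of an orthonormal sequence `κ n * P n`. -/
def IsNormalization {N : ℕ} (W : ℝ → CMat N) (P : ℕ → (CMat N)[X]) (κ : ℕ → CMat N) : Prop :=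
  ∀ n k : ℕ, innerW W (C (κ n) * P n) (C (κ k) * P k) = if n = k then 1 else 0

/-- `γ_n = κ_n* κ_n`. -/
def gammaCoef {N : ℕ} (κ : ℕ → CMat N) (n : ℕ) : CMat N :=
  (κ n).conjTranspose * κ n

/-- `a_{n,j}`: the coefficient of `x^j` in `P n`, which is zero for negative `j`. -/
noncomputable def aCoef {N : ℕ} (P : ℕ → (CMat N)[X]) (n : ℕ) (j : ℤ) : CMat N :=
  if 0 ≤ j then (P n).coeff j.toNat else 0

/-- `b_{n,k} = ∫ x^k P_n(x) W(x) dx` for `k ≥ n`, and `b_{n,k} = 0` for `k < n`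
(for `0 ≤ k < n` this is the value of the integral, by orthogonality). -/
noncomputable def bCoef {N : ℕ} (W : ℝ → CMat N) (P : ℕ → (CMat N)[X]) (n : ℕ) (k : ℤ) :
    CMat N :=
  if (n : ℤ) ≤ k then
    matIntegral fun x => ((x : ℂ) ^ k.toNat) • (matEval (P n) (x : ℂ) * W x)
  else 0

/-- `α_n = a_{n,n-1} - a_{n+1,n}`. -/
noncomputable def alphaCoef {N : ℕ} (P : ℕ → (CMat N)[X]) (n : ℕ) : CMat N :=
  aCoef P n ((n : ℤ) - 1) - aCoef P (n + 1) (n : ℤ)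

/-- `β_n = γ_n⁻¹ γ_{n-1}` for `n ≥ 1`, and `β_0 = 0`. -/
noncomputable def betaCoef {N : ℕ} (κ : ℕ → CMat N) : ℕ → CMat N
  | 0 => 0
  | n + 1 => (gammaCoef κ (n + 1))⁻¹ * gammaCoef κ n

/-- `P_{n,k}(z) = z^k I + a_{n,n-1} z^{k-1} + ⋯ + a_{n,n-k}`. -/
noncomputable def PTrunc {N : ℕ} (P : ℕ → (CMat N)[X]) (n k : ℕ) (z : ℂ) : CMat N :=
  ∑ i ∈ Finset.range (k + 1), (z ^ (k - i)) • aCoef P n ((n : ℤ) - (i : ℤ))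

/-- `Δ_{j,n}(z) = ∑_{k=0}^{j} P_{n,k}(z) M_{m-j+k}`, for `j ≤ m`, where `G = ∑_{j=0}^m M_j z^j`. -/
noncomputable def DeltaCoef {N : ℕ} (P : ℕ → (CMat N)[X]) (G : (CMat N)[X]) (m j n : ℕ) (z : ℂ) :
    CMat N :=
  ∑ k ∈ Finset.range (j + 1), PTrunc P n k z * G.coeff (m - j + k)

/-- `𝒜_n(z; G) = -γ_n ∑_{j=0}^{m-1} (b_{n,n+m-j-1} Δ_{j,n}*(z) + Δ_{j,n}(z) b_{n,n+m-j-1}*)`. -/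
noncomputable def calA {N : ℕ} (W : ℝ → CMat N) (P : ℕ → (CMat N)[X]) (κ : ℕ → CMat N)
    (G : (CMat N)[X]) (m n : ℕ) (z : ℂ) : CMat N :=
  -(gammaCoef κ n * ∑ j ∈ Finset.range m,
      (bCoef W P n ((n : ℤ) + m - j - 1) * matStar (DeltaCoef P G m j n) z
        + DeltaCoef P G m j n z * (bCoef W P n ((n : ℤ) + m - j - 1)).conjTranspose))

/-- For `n ≥ 1`, `ℬ_n(z; G)` is
`-(∑_{j=0}^{m} (Δ_{j,n}(z) b_{n-1,n+m-j-1}* + b_{n,n+m-j-2} Δ_{j,n-1}*(z))) γ_{n-1}`.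
For `n = 0`, where `γ_{-1} P_{-1} = 0` and `b_{-1,i-1}* γ_{-1}` stands for `I` if `i = 0` and
for `0` if `i ≥ 1`, the same formula reduces to `ℬ_0(z; G) = -Δ_{m,0}(z) = -G(z)`. -/
noncomputable def calB {N : ℕ} (W : ℝ → CMat N) (P : ℕ → (CMat N)[X]) (κ : ℕ → CMat N)
    (G : (CMat N)[X]) (m : ℕ) : ℕ → ℂ → CMat N
  | 0, z => -DeltaCoef P G m m 0 z
  | n + 1, z =>
    -((∑ j ∈ Finset.range (m + 1),
        (DeltaCoef P G m j (n + 1) z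
            * (bCoef W P n (((n + 1 : ℕ) : ℤ) + m - j - 1)).conjTranspose
          + bCoef W P (n + 1) (((n + 1 : ℕ) : ℤ) + m - j - 2)
            * matStar (DeltaCoef P G m j n) z))
      * gammaCoef κ n)

/-! The heart of the matter is that `F ↦ F' + F G` is skew-adjoint for `(·,·)_W`. Indeed `W = T T*`
and `T' = G T` give `W' = G W + W G*`, and finite moments remove the boundary terms
(`innerW_derivative_add`).

Let `K` be the reproducing kernel at `z` of the polynomials of degree at most `n`. It reproduces the
derivative of `P_{n+1}` but not `P_{n+1} G`, whose degree is too large. Writing `P_{n+1} G` as its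
value at `z` plus `(X - z) q` leaves the correction `(q, (X - z̄) K)`. By skew-adjointness the two
pairings with `K` sum to `-(P_{n+1}, K G)`, since `K'` is orthogonal to `P_{n+1}`.
Christoffel–Darboux expresses `(X - z̄) K` through `P_n` and `P_{n+1}`, and hence `K G` through the
divided differences of `P_n G` and `P_{n+1} G` at `z̄`; this is `derivative_add_mul_eq`.

The top coefficients of these divided differences are the `Δ_{j,n}`, and orthogonality kills the
lower ones, so the pairings become the finite sums in `calA` and `calB`. The raising relation
follows by eliminating `P_{n-1}` with the recurrence. Existence, uniqueness and normalization rest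
on positive definiteness of `(p, p)_W` when some coefficient of `p` is `1` (`posDef_innerW_self`).
-/

section MatEval

/-! ### Evaluation of matrix polynomials at scalars. -/

variable {N : ℕ}

theorem matEval_apply (P : (CMat N)[X]) (z : ℂ) (i j : Fin N) :
    matEval P z i j = ((matPolyEquiv.symm P) i j).eval z := by
  rw [← matPolyEquiv_eval, AlgEquiv.apply_symm_apply]; rfl

theorem matEval_eq_mapMatrix (P : (CMat N)[X]) (z : ℂ) :
    matEval P z = (evalRingHom z).mapMatrix (matPolyEquiv.symm P) := by
  ext i j; rw [matEval_apply]; rfl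

theorem matEval_add (P Q : (CMat N)[X]) (z : ℂ) :
    matEval (P + Q) z = matEval P z + matEval Q z := by simp [matEval]

theorem matEval_sub (P Q : (CMat N)[X]) (z : ℂ) :
    matEval (P - Q) z = matEval P z - matEval Q z := by simp [matEval]

theorem matEval_C (A : CMat N) (z : ℂ) : matEval (C A) z = A := by simp [matEval]

theorem matEval_zero (z : ℂ) : matEval (0 : (CMat N)[X]) z = 0 := by simp [matEval]

theorem matEval_one (z : ℂ) : matEval (1 : (CMat N)[X]) z = 1 := by simp [matEval]

theorem matEval_X (z : ℂ) : matEval (X : (CMat N)[X]) z = z • 1 := by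
  simp [matEval, ← Matrix.smul_one_eq_diagonal]

/-- Multiplicativity survives noncommuting coefficients because the evaluation point is a scalar
matrix, hence central. -/
theorem matEval_mul (P Q : (CMat N)[X]) (z : ℂ) :
    matEval (P * Q) z = matEval P z * matEval Q z := by
  simp only [matEval_eq_mapMatrix, map_mul]

theorem matEval_X_pow (k : ℕ) (z : ℂ) : matEval (X ^ k : (CMat N)[X]) z = z ^ k • 1 := by
  induction k with
  | zero => simp [matEval_one]
  | succ k ih => rw [pow_succ, matEval_mul, ih, matEval_X, smul_mul_smul_comm, one_mul, pow_succ]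

theorem matEval_sum {ι : Type*} (s : Finset ι) (F : ι → (CMat N)[X]) (z : ℂ) :
    matEval (∑ i ∈ s, F i) z = ∑ i ∈ s, matEval (F i) z := by
  simp only [matEval_eq_mapMatrix, map_sum]

theorem matEval_X_sub_C_scalar (w z : ℂ) :
    matEval (X - C (Matrix.scalar (Fin N) w)) z = (z - w) • 1 := by
  rw [matEval_sub, matEval_X, matEval_C, sub_smul, Matrix.scalar_apply,
    Matrix.smul_one_eq_diagonal w]

theorem hasDerivAt_matEval (P : (CMat N)[X]) (i j : Fin N) (x : ℝ) :
    HasDerivAt (fun t : ℝ => matEval P (t : ℂ) i j) (matEval (derivative P) (x : ℂ) i j) x := by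
  simp only [matEval_apply]
  have h : (matPolyEquiv.symm (derivative P)) i j = derivative ((matPolyEquiv.symm P) i j) := by
    ext k
    rw [coeff_derivative, matPolyEquiv_symm_apply_coeff, matPolyEquiv_symm_apply_coeff,
      coeff_derivative]
    have : ((k : CMat N) + 1) = ((k : ℂ) + 1) • (1 : CMat N) := by
      rw [add_smul, one_smul, Nat.cast_smul_eq_nsmul ℂ k, nsmul_one]
    rw [this, Matrix.mul_smul, mul_one, Matrix.smul_apply, smul_eq_mul, mul_comm]
  rw [h]
  exact (Polynomial.hasDerivAt _ _).comp_ofReal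

theorem eq_zero_of_matEval_ofReal_eq_zero (P : (CMat N)[X])
    (h : ∀ x : ℝ, matEval P (x : ℂ) = 0) : P = 0 := by
  have : matPolyEquiv.symm P = 0 := by
    ext1 i j
    refine eq_zero_of_infinite_isRoot _ (Set.Infinite.mono ?_
      (Set.infinite_range_of_injective Complex.ofReal_injective))
    rintro _ ⟨x, rfl⟩
    show IsRoot _ _
    rw [IsRoot, ← matEval_apply, h x]; rfl
  simpa using this

end MatEval

/-! ### Entrywise integrals and the matrix-valued sesquilinear form. -/

section MatIntegral

variable {N : ℕ}

theorem matIntegral_apply (F : ℝ → CMat N) (i j : Fin N) :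
    matIntegral F i j = ∫ x : ℝ, F x i j := rfl

theorem matIntegral_add {F H : ℝ → CMat N}
    (hF : ∀ i j, Integrable (fun x => F x i j)) (hH : ∀ i j, Integrable (fun x => H x i j)) :
    matIntegral (fun x => F x + H x) = matIntegral F + matIntegral H := by
  ext i j
  simp only [matIntegral_apply, Matrix.add_apply]
  exact integral_add (hF i j) (hH i j)

theorem matIntegral_const_mul (A : CMat N) {F : ℝ → CMat N}
    (hF : ∀ i j, Integrable (fun x => F x i j)) :
    matIntegral (fun x => A * F x) = A * matIntegral F := by
  ext i j
  simp only [matIntegral_apply, Matrix.mul_apply]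
  rw [integral_finsetSum _ fun k _ => (hF k j).const_mul _]
  simp only [integral_const_mul]

theorem matIntegral_conjTranspose (F : ℝ → CMat N) :
    matIntegral (fun x => (F x).conjTranspose) = (matIntegral F).conjTranspose := by
  ext i j
  simp only [matIntegral_apply, Matrix.conjTranspose_apply]
  exact integral_conj

end MatIntegral

/-- A Hermitian matrix weight on the line with finite moments. -/
structure IsMomentWeight {N : ℕ} (W : ℝ → CMat N) : Prop where
  isHermitian : ∀ x, (W x).IsHermitian
  moments : ∀ (k : ℕ) (i j : Fin N), Integrable (fun x : ℝ => (x : ℂ) ^ k * W x i j) volume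

namespace IsMomentWeight

variable {N : ℕ} {W : ℝ → CMat N}

theorem integrable_eval_mul (hW : IsMomentWeight W) (p : ℂ[X]) (i j : Fin N) :
    Integrable (fun x : ℝ => p.eval (x : ℂ) * W x i j) := by
  simp only [eval_eq_sum_range, Finset.sum_mul, mul_assoc]
  exact integrable_finsetSum _ fun k _ => (hW.moments k i j).const_mul _

theorem integrable (hW : IsMomentWeight W) (P Q : (CMat N)[X]) (i j : Fin N) :
    Integrable (fun x : ℝ =>
      (matEval P (x : ℂ) * W x * (matEval Q (x : ℂ)).conjTranspose) i j) := by
  simp only [Matrix.mul_apply, Finset.sum_mul, Matrix.conjTranspose_apply, matEval_apply]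
  refine integrable_finsetSum _ fun l _ => integrable_finsetSum _ fun k _ => ?_
  refine (hW.integrable_eval_mul ((matPolyEquiv.symm P) i k *
    ((matPolyEquiv.symm Q) j l).map (starRingEnd ℂ)) k l).congr (ae_of_all _ fun x => ?_)
  have : (((matPolyEquiv.symm Q) j l).map (starRingEnd ℂ)).eval (x : ℂ)
      = star (((matPolyEquiv.symm Q) j l).eval (x : ℂ)) := by
    have h := Polynomial.eval_map_apply (p := (matPolyEquiv.symm Q) j l) (starRingEnd ℂ) (x : ℂ)
    rwa [Complex.conj_ofReal] at h
  simp only [eval_mul, this]; ring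

theorem innerW_add_left (hW : IsMomentWeight W) (P P' Q : (CMat N)[X]) :
    innerW W (P + P') Q = innerW W P Q + innerW W P' Q := by
  simp only [innerW, matEval_add, add_mul]
  exact matIntegral_add (hW.integrable P Q) (hW.integrable P' Q)

theorem innerW_C_mul_left (hW : IsMomentWeight W) (A : CMat N) (P Q : (CMat N)[X]) :
    innerW W (C A * P) Q = A * innerW W P Q := by
  simp only [innerW, matEval_mul, matEval_C, mul_assoc]
  simpa only [mul_assoc] using matIntegral_const_mul A (hW.integrable P Q)

theorem conjTranspose_innerW (hW : IsMomentWeight W) (P Q : (CMat N)[X]) :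
    (innerW W P Q).conjTranspose = innerW W Q P := by
  simp only [innerW, ← matIntegral_conjTranspose, Matrix.conjTranspose_mul,
    Matrix.conjTranspose_conjTranspose, (hW.isHermitian _).eq, mul_assoc]

theorem innerW_add_right (hW : IsMomentWeight W) (P Q Q' : (CMat N)[X]) :
    innerW W P (Q + Q') = innerW W P Q + innerW W P Q' := by
  rw [← hW.conjTranspose_innerW, hW.innerW_add_left, Matrix.conjTranspose_add,
    hW.conjTranspose_innerW, hW.conjTranspose_innerW]

theorem innerW_C_mul_right (hW : IsMomentWeight W) (A : CMat N) (P Q : (CMat N)[X]) :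
    innerW W P (C A * Q) = innerW W P Q * A.conjTranspose := by
  rw [← hW.conjTranspose_innerW, hW.innerW_C_mul_left, Matrix.conjTranspose_mul,
    hW.conjTranspose_innerW]

theorem innerW_sub_left (hW : IsMomentWeight W) (P P' Q : (CMat N)[X]) :
    innerW W (P - P') Q = innerW W P Q - innerW W P' Q := by
  rw [eq_sub_iff_add_eq, ← hW.innerW_add_left, sub_add_cancel]

theorem innerW_sub_right (hW : IsMomentWeight W) (P Q Q' : (CMat N)[X]) :
    innerW W P (Q - Q') = innerW W P Q - innerW W P Q' := by
  rw [eq_sub_iff_add_eq, ← hW.innerW_add_right, sub_add_cancel]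

theorem innerW_sum_left (hW : IsMomentWeight W) {ι : Type*} (s : Finset ι) (F : ι → (CMat N)[X])
    (Q : (CMat N)[X]) : innerW W (∑ i ∈ s, F i) Q = ∑ i ∈ s, innerW W (F i) Q :=
  map_sum (AddMonoidHom.mk' (innerW W · Q) fun _ _ => hW.innerW_add_left _ _ _) F s

theorem innerW_sum_right (hW : IsMomentWeight W) {ι : Type*} (s : Finset ι) (P : (CMat N)[X])
    (F : ι → (CMat N)[X]) : innerW W P (∑ i ∈ s, F i) = ∑ i ∈ s, innerW W P (F i) :=
  map_sum (AddMonoidHom.mk' (innerW W P ·) fun _ _ => hW.innerW_add_right _ _ _) F s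

end IsMomentWeight

/-- For real `x` the conjugate of `x - w̄` is `x - w`, a scalar that passes through `W`. -/
theorem innerW_X_sub_C_mul {N : ℕ} (W : ℝ → CMat N) (w : ℂ) (P Q : (CMat N)[X]) :
    innerW W ((X - C (Matrix.scalar (Fin N) w)) * P) Q
      = innerW W P ((X - C (Matrix.scalar (Fin N) (starRingEnd ℂ w))) * Q) := by
  unfold innerW
  congr 1; ext1 x
  simp only [matEval_mul, matEval_X_sub_C_scalar, Matrix.conjTranspose_mul,
    Matrix.conjTranspose_smul]
  simp

theorem innerW_X_mul {N : ℕ} (W : ℝ → CMat N) (P Q : (CMat N)[X]) :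
    innerW W (X * P) Q = innerW W P (X * Q) := by
  simpa using innerW_X_sub_C_mul W 0 P Q

/-! ### Skew-adjointness of `F ↦ F' + F G`, and positivity. -/

section Derivative

variable {N : ℕ} {W T : ℝ → CMat N} {G : (CMat N)[X]}

theorem hasDerivAt_matrix_mul {F H : ℝ → CMat N} {F' H' : CMat N} {x : ℝ}
    (hF : ∀ i j, HasDerivAt (fun t => F t i j) (F' i j) x)
    (hH : ∀ i j, HasDerivAt (fun t => H t i j) (H' i j) x) (i j : Fin N) :
    HasDerivAt (fun t => (F t * H t) i j) ((F' * H x + F x * H') i j) x := by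
  simp only [Matrix.mul_apply, Matrix.add_apply, ← Finset.sum_add_distrib]
  exact HasDerivAt.fun_sum fun k _ => (hF i k).mul (hH k j)

theorem hasDerivAt_matrix_conjTranspose {F : ℝ → CMat N} {F' : CMat N} {x : ℝ}
    (hF : ∀ i j, HasDerivAt (fun t => F t i j) (F' i j) x) (i j : Fin N) :
    HasDerivAt (fun t => (F t).conjTranspose i j) (F'.conjTranspose i j) x := by
  simp only [Matrix.conjTranspose_apply]
  exact (hF j i).star

/-- In the product rule, `W' = G W + W G*` attaches one `G` to `P` and the other to `Q`. -/
theorem hasDerivAt_innerW_integrand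
    (hWT : ∀ x : ℝ, W x = T x * (T x).conjTranspose)
    (hT : ∀ (x : ℝ) (i j : Fin N),
      HasDerivAt (fun t : ℝ => T t i j) ((matEval G (x : ℂ) * T x) i j) x)
    (P Q : (CMat N)[X]) (x : ℝ) (i j : Fin N) :
    HasDerivAt
      (fun t : ℝ => (matEval P (t : ℂ) * W t * (matEval Q (t : ℂ)).conjTranspose) i j)
      ((matEval (derivative P + P * G) (x : ℂ) * W x * (matEval Q (x : ℂ)).conjTranspose) i j
        + (matEval P (x : ℂ) * W x *
          (matEval (derivative Q + Q * G) (x : ℂ)).conjTranspose) i j) x := by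
  have h1 := hasDerivAt_matrix_mul
    (hasDerivAt_matrix_mul (fun i j => hasDerivAt_matEval P i j x)
      (hasDerivAt_matrix_mul (hT x) (hasDerivAt_matrix_conjTranspose (hT x))))
    (hasDerivAt_matrix_conjTranspose fun i j => hasDerivAt_matEval Q i j x) i j
  simp only [← hWT] at h1
  convert h1 using 1
  rw [← Matrix.add_apply]
  refine congrFun (congrFun ?_ i) j
  simp only [hWT, matEval_add, matEval_mul, Matrix.conjTranspose_mul, Matrix.conjTranspose_add]
  simp only [add_mul, mul_add, mul_assoc]
  abel

theorem innerW_derivative_add (hW : IsMomentWeight W)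
    (hWT : ∀ x : ℝ, W x = T x * (T x).conjTranspose)
    (hT : ∀ (x : ℝ) (i j : Fin N),
      HasDerivAt (fun t : ℝ => T t i j) ((matEval G (x : ℂ) * T x) i j) x)
    (P Q : (CMat N)[X]) :
    innerW W (derivative P + P * G) Q = -innerW W P (derivative Q + Q * G) := by
  rw [eq_neg_iff_add_eq_zero]
  unfold innerW
  rw [← matIntegral_add (hW.integrable _ _) (hW.integrable _ _)]
  ext i j
  -- The integrand and its derivative are both combinations of moments of `W`, hence integrable, so
  -- no decay at infinity has to be assumed.
  exact integral_eq_zero_of_hasDerivAt_of_integrable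
    (fun x => hasDerivAt_innerW_integrand hWT hT P Q x i j)
    ((hW.integrable _ _ i j).add (hW.integrable _ _ i j)) (hW.integrable _ _ i j)

theorem posDef_innerW_self (hW : IsMomentWeight W) (hpos : ∀ x, (W x).PosDef)
    (hWT : ∀ x : ℝ, W x = T x * (T x).conjTranspose)
    (hT : ∀ (x : ℝ) (i j : Fin N),
      HasDerivAt (fun t : ℝ => T t i j) ((matEval G (x : ℂ) * T x) i j) x)
    {P : (CMat N)[X]} {n : ℕ} (hP : P.coeff n = 1) : (innerW W P P).PosDef := by
  refine Matrix.PosDef.of_dotProduct_mulVec_pos (hW.conjTranspose_innerW P P) fun v hv => ?_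
  set f : ℝ → ℂ := fun x =>
    star v ⬝ᵥ ((matEval P (x : ℂ) * W x * (matEval P (x : ℂ)).conjTranspose).mulVec v) with hf
  have hsum : ∀ x, f x = ∑ i, ∑ j, star v i *
      ((matEval P (x : ℂ) * W x * (matEval P (x : ℂ)).conjTranspose) i j * v j) := by
    intro x; simp only [hf, dotProduct, Matrix.mulVec, Finset.mul_sum]
  have hint : Integrable f := by
    rw [funext hsum]
    exact integrable_finsetSum _ fun i _ => integrable_finsetSum _ fun j _ =>
      ((hW.integrable P P i j).mul_const _).const_mul _
  have heq : star v ⬝ᵥ ((innerW W P P).mulVec v) = ∫ x, f x := by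
    rw [funext hsum, integral_finsetSum _ fun i _ => integrable_finsetSum _ fun j _ =>
      ((hW.integrable P P i j).mul_const _).const_mul _]
    simp only [dotProduct, Matrix.mulVec, Finset.mul_sum]
    refine Finset.sum_congr rfl fun i _ => ?_
    rw [integral_finsetSum _ fun j _ => ((hW.integrable P P i j).mul_const _).const_mul _]
    simp only [integral_const_mul, integral_mul_const, innerW, matIntegral_apply]
  -- Continuity, inherited from the differentiability of `T`, lets one point with `f x ≠ 0` force a
  -- positive integral.
  have hcont : Continuous f := by
    rw [funext hsum]
    refine continuous_finsetSum _ fun i _ => continuous_finsetSum _ fun j _ => ?_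
    exact continuous_const.mul ((continuous_iff_continuousAt.2 fun x =>
      (hasDerivAt_innerW_integrand hWT hT P P x i j).continuousAt).mul continuous_const)
  have hfu : ∀ x, f x = star ((matEval P (x : ℂ)).conjTranspose.mulVec v) ⬝ᵥ
      ((W x).mulVec ((matEval P (x : ℂ)).conjTranspose.mulVec v)) := by
    intro x
    simp only [hf, ← Matrix.mulVec_mulVec, Matrix.dotProduct_mulVec, Matrix.star_mulVec,
      Matrix.conjTranspose_conjTranspose]
  have hnn : ∀ x, 0 ≤ f x := fun x => by
    rw [hfu]; exact (hpos x).posSemidef.dotProduct_mulVec_nonneg _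
  have hre : ∀ x, f x = ((f x).re : ℂ) := fun x =>
    Complex.ext (by simp) (by simpa using (Complex.nonneg_iff.1 (hnn x)).2.symm)
  obtain ⟨x, hx⟩ : ∃ x, f x ≠ 0 := by
    by_contra! h0
    have hu : ∀ x : ℝ, (matEval P (x : ℂ)).conjTranspose.mulVec v = 0 := fun x => by
      by_contra hne
      have := (hpos x).dotProduct_mulVec_pos hne
      rw [← hfu, h0] at this
      exact this.ne rfl
    -- Repeating the row `star v` turns the vector identity into a polynomial one; its `n`-th
    -- coefficient then gives `v = 0`.
    have hz : C (Matrix.of fun _ : Fin N => star v) * P = 0 := by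
      refine eq_zero_of_matEval_ofReal_eq_zero _ fun x => ?_
      rw [matEval_mul, matEval_C]
      have := congrArg star (hu x)
      rw [Matrix.star_mulVec, Matrix.conjTranspose_conjTranspose] at this
      ext i j
      simpa [Matrix.mul_apply, Matrix.vecMul, dotProduct] using congrFun this j
    have hc := congrArg (fun F => coeff F n) hz
    simp only [coeff_C_mul, hP, mul_one, coeff_zero] at hc
    apply hv
    ext i
    simpa using congrFun (congrFun hc i) i
  have hofReal : ∫ x, f x = ((∫ x, (f x).re : ℝ) : ℂ) := by
    exact (integral_congr_ae (ae_of_all _ hre)).trans integral_complex_ofReal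
  rw [heq, hofReal, Complex.zero_lt_real]
  refine integral_pos_of_integrable_nonneg_nonzero (Complex.continuous_re.comp hcont) hint.re
    (fun x => (Complex.nonneg_iff.1 (hnn x)).1) (x := x) fun h => hx ?_
  rw [hre x]; exact_mod_cast h

end Derivative

/-! ### Gram–Schmidt: existence, uniqueness and normalization. -/

section MonicOrthogonal

variable {N : ℕ} {W : ℝ → CMat N}

/-- `p` is monic of degree `n` and orthogonal to all polynomials of degree less than `n`. -/
def IsMonicOrthogonal (W : ℝ → CMat N) (n : ℕ) (p : (CMat N)[X]) : Prop :=
  p.natDegree ≤ n ∧ p.coeff n = 1 ∧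
    ∀ Q : (CMat N)[X], Q.degree < (n : WithBot ℕ) → innerW W p Q = 0

namespace IsMonicOrthogonal

theorem coeff_eq_zero {n k : ℕ} {p : (CMat N)[X]} (hp : IsMonicOrthogonal W n p) (hk : n < k) :
    p.coeff k = 0 :=
  coeff_eq_zero_of_natDegree_lt (hp.1.trans_lt hk)

theorem degree_lt {n k : ℕ} {p : (CMat N)[X]} (hp : IsMonicOrthogonal W n p) (hk : n < k) :
    p.degree < k :=
  (degree_le_of_natDegree_le hp.1).trans_lt (by exact_mod_cast hk)

theorem innerW_eq_zero_of_lt (hW : IsMomentWeight W) {n k : ℕ} {p q : (CMat N)[X]}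
    (hp : IsMonicOrthogonal W n p) (hq : IsMonicOrthogonal W k q) (h : n ≠ k) :
    innerW W p q = 0 := by
  rcases h.lt_or_gt with h | h
  · rw [← hW.conjTranspose_innerW, hq.2.2 p (hp.degree_lt h), Matrix.conjTranspose_zero]
  · exact hp.2.2 q (hq.degree_lt h)

end IsMonicOrthogonal

/-- Induction strips the top coefficient. Only indices below `n` are assumed, so the expansion is
available while `P n` is still being constructed. -/
theorem eq_sum_C_innerW_mul (hW : IsMomentWeight W) {P : ℕ → (CMat N)[X]} {Γ : ℕ → CMat N}
    (n : ℕ) (hP : ∀ k < n, IsMonicOrthogonal W k (P k))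
    (hΓ : ∀ k < n, innerW W (P k) (P k) * Γ k = 1) {F : (CMat N)[X]} (hF : F.degree < n) :
    F = ∑ k ∈ Finset.range n, C (innerW W F (P k) * Γ k) * P k := by
  induction n generalizing F with
  | zero =>
    simpa using hF
  | succ n ih =>
    have hF' : (F - C (F.coeff n) * P n).degree < (n : WithBot ℕ) := by
      rw [degree_lt_iff_coeff_zero] at hF ⊢
      intro k hk
      rw [coeff_sub, coeff_C_mul]
      rcases hk.eq_or_lt with rfl | hk
      · rw [(hP n n.lt_succ_self).2.1, mul_one, sub_self]
      · rw [(hP n n.lt_succ_self).coeff_eq_zero hk, hF k hk, mul_zero, sub_zero]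
    have h := ih (fun k hk => hP k (hk.trans n.lt_succ_self))
      (fun k hk => hΓ k (hk.trans n.lt_succ_self)) hF'
    have hc : innerW W F (P n) * Γ n = F.coeff n := by
      have h1 : innerW W (F - C (F.coeff n) * P n) (P n) = 0 := by
        rw [← hW.conjTranspose_innerW, (hP n n.lt_succ_self).2.2 _ hF', Matrix.conjTranspose_zero]
      rw [hW.innerW_sub_left, hW.innerW_C_mul_left, sub_eq_zero] at h1
      rw [h1, mul_assoc, hΓ n n.lt_succ_self, mul_one]
    rw [Finset.sum_range_succ, hc, ← sub_eq_iff_eq_add, h]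
    refine Finset.sum_congr rfl fun k hk => ?_
    have hk := Finset.mem_range.1 hk
    rw [hW.innerW_sub_left, hW.innerW_C_mul_left,
      (hP n n.lt_succ_self).innerW_eq_zero_of_lt hW (hP k (hk.trans n.lt_succ_self)) hk.ne',
      mul_zero, sub_zero]

theorem eq_zero_of_innerW_eq_zero (hW : IsMomentWeight W) {P : ℕ → (CMat N)[X]} {Γ : ℕ → CMat N}
    (n : ℕ) (hP : ∀ k < n, IsMonicOrthogonal W k (P k))
    (hΓ : ∀ k < n, innerW W (P k) (P k) * Γ k = 1) {F : (CMat N)[X]} (hF : F.degree < n)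
    (h : ∀ k < n, innerW W F (P k) = 0) : F = 0 := by
  rw [eq_sum_C_innerW_mul hW n hP hΓ hF]
  refine Finset.sum_eq_zero fun k hk => ?_
  rw [h k (Finset.mem_range.1 hk), zero_mul, map_zero, zero_mul]

theorem innerW_self_mul_inv {p : (CMat N)[X]} (h : (innerW W p p).PosDef) :
    innerW W p p * (innerW W p p)⁻¹ = 1 :=
  Matrix.mul_nonsing_inv _ ((Matrix.isUnit_iff_isUnit_det _).1 h.isUnit)

theorem exists_isMonicOrthogonal (hW : IsMomentWeight W)
    (hdef : ∀ (p : (CMat N)[X]) (n : ℕ), p.coeff n = 1 → (innerW W p p).PosDef) (n : ℕ) :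
    ∃ p, IsMonicOrthogonal W n p := by
  induction n using Nat.strong_induction_on with
  | _ n ih =>
    choose! P hP using ih
    have hΓ : ∀ k < n, innerW W (P k) (P k) * (innerW W (P k) (P k))⁻¹ = 1 := fun k hk =>
      innerW_self_mul_inv (hdef _ k (hP k hk).2.1)
    set S := ∑ k ∈ Finset.range n,
      C (innerW W (X ^ n) (P k) * (innerW W (P k) (P k))⁻¹) * P k with hS
    have hSdeg : S.degree < n := by
      rw [degree_lt_iff_coeff_zero]
      intro i hi
      rw [hS, finsetSum_coeff]
      refine Finset.sum_eq_zero fun k hk => ?_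
      have hk := Finset.mem_range.1 hk
      rw [coeff_C_mul, (hP k hk).coeff_eq_zero (hk.trans_le hi), mul_zero]
    have hSc := (degree_lt_iff_coeff_zero _ _).1 hSdeg
    refine ⟨X ^ n - S, ?_, ?_, fun Q hQ => ?_⟩
    · exact (natDegree_sub_le_of_le (natDegree_X_pow_le n)
        (natDegree_le_of_degree_le hSdeg.le)).trans (max_self n).le
    · rw [coeff_sub, coeff_X_pow_self, hSc n le_rfl, sub_zero]
    · rw [eq_sum_C_innerW_mul hW n hP hΓ hQ, hW.innerW_sum_right]
      refine Finset.sum_eq_zero fun j hj => ?_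
      have hj' := Finset.mem_range.1 hj
      rw [hW.innerW_C_mul_right, hW.innerW_sub_left, hS, hW.innerW_sum_left,
        Finset.sum_eq_single_of_mem j hj, hW.innerW_C_mul_left, mul_assoc,
        Matrix.nonsing_inv_mul _ ((Matrix.isUnit_iff_isUnit_det _).1
          (hdef _ j (hP j hj').2.1).isUnit), mul_one, sub_self, zero_mul]
      intro k hk hkj
      rw [hW.innerW_C_mul_left,
        (hP k (Finset.mem_range.1 hk)).innerW_eq_zero_of_lt hW (hP j hj') hkj, mul_zero]

theorem existsUnique_isMonicMOPRL (hW : IsMomentWeight W)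
    (hdef : ∀ (p : (CMat N)[X]) (n : ℕ), p.coeff n = 1 → (innerW W p p).PosDef) :
    ∃! P : ℕ → (CMat N)[X], IsMonicMOPRL W P := by
  choose P hP using exists_isMonicOrthogonal hW hdef
  refine ⟨P, hP, fun Q hQ => funext fun n => ?_⟩
  have hQ' : IsMonicOrthogonal W n (Q n) := hQ n
  rw [← sub_eq_zero]
  have hdeg : (Q n - P n).degree < n := by
    rw [degree_lt_iff_coeff_zero]
    intro k hk
    rw [coeff_sub]
    rcases hk.eq_or_lt with rfl | hk
    · rw [hQ'.2.1, (hP n).2.1, sub_self]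
    · rw [hQ'.coeff_eq_zero hk, (hP n).coeff_eq_zero hk, sub_zero]
  refine eq_zero_of_innerW_eq_zero hW n (fun k _ => hP k)
    (fun k _ => innerW_self_mul_inv (hdef _ k (hP k).2.1)) hdeg fun k hk => ?_
  rw [hW.innerW_sub_left, hQ'.2.2 _ ((hP k).degree_lt hk),
    (hP n).2.2 _ ((hP k).degree_lt hk), sub_self]

open scoped MatrixOrder in
theorem exists_isNormalization (hW : IsMomentWeight W)
    (hdef : ∀ (p : (CMat N)[X]) (n : ℕ), p.coeff n = 1 → (innerW W p p).PosDef)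
    {P : ℕ → (CMat N)[X]} (hP : IsMonicMOPRL W P) : ∃ κ, IsNormalization W P κ := by
  have hpd : ∀ n, (innerW W (P n) (P n)).PosDef := fun n => hdef _ n (hP n).2.1
  have h : ∀ n, ∃ κ : CMat N, (innerW W (P n) (P n))⁻¹ = star κ * κ := fun n =>
    CStarAlgebra.nonneg_iff_eq_star_mul_self.mp (hpd n).inv.posSemidef.nonneg
  choose κ hκ using h
  refine ⟨κ, fun n k => ?_⟩
  rw [hW.innerW_C_mul_left, hW.innerW_C_mul_right]
  split_ifs with hnk
  · subst hnk
    have h1 := innerW_self_mul_inv (hpd n)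
    rw [hκ, ← mul_assoc] at h1
    -- With `H = (P_n, P_n)_W`, cyclically moving a factor in `H κ* κ = 1` gives `κ H κ* = 1`:
    -- one-sided inverses of square matrices are two-sided.
    exact mul_eq_one_comm.1 h1
  · rw [IsMonicOrthogonal.innerW_eq_zero_of_lt hW (hP n) (hP k) hnk, zero_mul, mul_zero]

theorem IsNormalization.innerW_self_mul_gammaCoef (hW : IsMomentWeight W)
    {P : ℕ → (CMat N)[X]} {κ : ℕ → CMat N} (hκ : IsNormalization W P κ) (n : ℕ) :
    innerW W (P n) (P n) * gammaCoef κ n = 1 := by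
  have h := hκ n n
  rw [if_pos rfl, hW.innerW_C_mul_left, hW.innerW_C_mul_right] at h
  rw [gammaCoef, ← mul_assoc]
  exact mul_eq_one_comm.1 h

end MonicOrthogonal

/-- Monic orthogonal polynomials `P n` together with the inverses `Γ n` of their squared norms. -/
structure IsOrthogonalSystem {N : ℕ} (W : ℝ → CMat N) (P : ℕ → (CMat N)[X]) (Γ : ℕ → CMat N) :
    Prop where
  weight : IsMomentWeight W
  monic : ∀ n, IsMonicOrthogonal W n (P n)
  innerW_self_mul : ∀ n, innerW W (P n) (P n) * Γ n = 1

/-- The reproducing kernel of the polynomials of degree less than `n`, as a polynomial. -/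
noncomputable def reproducingKernel {N : ℕ} (P : ℕ → (CMat N)[X]) (Γ : ℕ → CMat N) (n : ℕ) (z : ℂ) :
    (CMat N)[X] :=
  ∑ k ∈ Finset.range n, C ((matEval (P k) z).conjTranspose * Γ k) * P k

/-! ### Reproducing kernel, three-term recurrence and Christoffel–Darboux. -/

namespace IsOrthogonalSystem

variable {N : ℕ} {W : ℝ → CMat N} {P : ℕ → (CMat N)[X]} {Γ : ℕ → CMat N}

theorem mul_innerW_self (h : IsOrthogonalSystem W P Γ) (n : ℕ) :
    Γ n * innerW W (P n) (P n) = 1 :=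
  mul_eq_one_comm.1 (h.innerW_self_mul n)

theorem isHermitian_gamma (h : IsOrthogonalSystem W P Γ) (n : ℕ) : (Γ n).conjTranspose = Γ n := by
  have h1 := congrArg Matrix.conjTranspose (h.innerW_self_mul n)
  rw [Matrix.conjTranspose_mul, h.weight.conjTranspose_innerW, Matrix.conjTranspose_one] at h1
  exact left_inv_eq_right_inv h1 (h.innerW_self_mul n)

theorem innerW_eq_zero (h : IsOrthogonalSystem W P Γ) {n k : ℕ} (hnk : n ≠ k) :
    innerW W (P n) (P k) = 0 :=
  (h.monic n).innerW_eq_zero_of_lt h.weight (h.monic k) hnk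

theorem innerW_reproducingKernel (h : IsOrthogonalSystem W P Γ) {n : ℕ} {F : (CMat N)[X]}
    (hF : F.degree < n) (z : ℂ) : innerW W F (reproducingKernel P Γ n z) = matEval F z := by
  conv_rhs => rw [eq_sum_C_innerW_mul h.weight n (fun k _ => h.monic k)
    (fun k _ => h.innerW_self_mul k) hF]
  rw [reproducingKernel, h.weight.innerW_sum_right, matEval_sum]
  refine Finset.sum_congr rfl fun k _ => ?_
  rw [h.weight.innerW_C_mul_right, matEval_mul, matEval_C, Matrix.conjTranspose_mul,
    Matrix.conjTranspose_conjTranspose, h.isHermitian_gamma, mul_assoc]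

theorem degree_reproducingKernel_lt (h : IsOrthogonalSystem W P Γ) (n : ℕ) (z : ℂ) :
    (reproducingKernel P Γ n z).degree < n := by
  rw [degree_lt_iff_coeff_zero]
  intro i hi
  rw [reproducingKernel, finsetSum_coeff]
  refine Finset.sum_eq_zero fun k hk => ?_
  rw [coeff_C_mul, (h.monic k).coeff_eq_zero ((Finset.mem_range.1 hk).trans_le hi), mul_zero]

/-- Monicity cancels `x^{n+1}`, and `α_n` is exactly what cancels `x^n`; for `n = 0` this uses
`a_{0,-1} = 0`. -/
theorem degree_recurrence_remainder_lt (h : IsOrthogonalSystem W P Γ) (n : ℕ) :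
    (X * P n - P (n + 1) - C (alphaCoef P n) * P n).degree < (n : WithBot ℕ) := by
  rw [degree_lt_iff_coeff_zero]
  intro k hk
  simp only [coeff_sub, coeff_C_mul]
  rcases hk.eq_or_lt with rfl | hk
  · rw [(h.monic n).2.1, mul_one, alphaCoef]
    cases n with
    | zero => simp [aCoef]
    | succ n =>
      have : (0 : ℤ) ≤ (n : ℤ) + 1 := by positivity
      simp [aCoef, coeff_X_mul, this]
  · obtain ⟨k, rfl⟩ : ∃ j, k = j + 1 := ⟨k - 1, by omega⟩
    rw [coeff_X_mul, (h.monic n).coeff_eq_zero hk, mul_zero, sub_zero]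
    rcases (Nat.lt_succ_iff.1 hk).eq_or_lt with rfl | hk
    · rw [(h.monic n).2.1, (h.monic (n + 1)).2.1, sub_self]
    · rw [(h.monic n).coeff_eq_zero hk, (h.monic (n + 1)).coeff_eq_zero (by omega), sub_zero]

theorem innerW_recurrence_remainder (h : IsOrthogonalSystem W P Γ) {n k : ℕ} (hk : k < n) :
    innerW W (X * P n - P (n + 1) - C (alphaCoef P n) * P n) (P k)
      = innerW W (P n) (X * P k) := by
  rw [h.weight.innerW_sub_left, h.weight.innerW_sub_left, h.weight.innerW_C_mul_left,
    h.innerW_eq_zero hk.ne', h.innerW_eq_zero (show n + 1 ≠ k by omega), mul_zero, sub_zero,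
    sub_zero, innerW_X_mul]

theorem X_mul_zero (h : IsOrthogonalSystem W P Γ) :
    X * P 0 = P 1 + C (alphaCoef P 0) * P 0 := by
  have := h.degree_recurrence_remainder_lt 0
  rw [sub_sub, degree_lt_iff_coeff_zero] at this
  exact sub_eq_zero.1 (ext fun k => this k k.zero_le)

theorem X_mul_succ (h : IsOrthogonalSystem W P Γ) (n : ℕ) :
    X * P (n + 1) = P (n + 2) + C (alphaCoef P (n + 1)) * P (n + 1)
      + C (innerW W (P (n + 1)) (P (n + 1)) * Γ n) * P n := by
  have h1 := eq_sum_C_innerW_mul h.weight (n + 1) (fun k _ => h.monic k)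
    (fun k _ => h.innerW_self_mul k) (h.degree_recurrence_remainder_lt (n + 1))
  have hdeg : ∀ k, (X * P k - P (k + 1)).degree < ((k + 1 : ℕ) : WithBot ℕ) := fun k => by
    have := (h.degree_recurrence_remainder_lt k).trans (b := ((k : ℕ) : WithBot ℕ))
      (c := ((k + 1 : ℕ) : WithBot ℕ)) (by exact_mod_cast k.lt_succ_self)
    rw [← sub_add_cancel (X * P k - P (k + 1)) (C (alphaCoef P k) * P k)]
    refine (degree_add_le _ _).trans_lt (max_lt this ?_)
    rw [degree_lt_iff_coeff_zero]
    intro i hi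
    rw [coeff_C_mul, (h.monic k).coeff_eq_zero hi, mul_zero]
  -- `X P_k` and `P_{k+1}` differ by degree at most `k`, which `P_{n+1}` does not see.
  have hX : ∀ k ≤ n, innerW W (P (n + 1)) (X * P k) = innerW W (P (n + 1)) (P (k + 1)) := by
    intro k hk
    rw [← sub_eq_zero, ← h.weight.innerW_sub_right]
    exact (h.monic (n + 1)).2.2 _ ((hdeg k).trans_le (by exact_mod_cast Nat.succ_le_succ hk))
  rw [Finset.sum_range_succ, Finset.sum_eq_zero, zero_add,
    h.innerW_recurrence_remainder n.lt_succ_self, hX n le_rfl] at h1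
  · rw [← h1]; abel
  · intro k hk
    have hk := Finset.mem_range.1 hk
    rw [h.innerW_recurrence_remainder (by omega), hX k hk.le, h.innerW_eq_zero (by omega),
      zero_mul, map_zero, zero_mul]

/-- `α_n (P_n, P_n)_W = (X P_n, P_n)_W` is Hermitian, because multiplication by `X` is symmetric. -/
theorem gamma_mul_alphaCoef (h : IsOrthogonalSystem W P Γ) (n : ℕ) :
    Γ n * alphaCoef P n = (alphaCoef P n).conjTranspose * Γ n := by
  have h1 : innerW W (X * P n) (P n) = alphaCoef P n * innerW W (P n) (P n) := by
    have h2 : innerW W (X * P n - P (n + 1) - C (alphaCoef P n) * P n) (P n) = 0 := by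
      rw [← h.weight.conjTranspose_innerW,
        (h.monic n).2.2 _ (h.degree_recurrence_remainder_lt n), Matrix.conjTranspose_zero]
    rw [h.weight.innerW_sub_left, h.weight.innerW_sub_left, h.weight.innerW_C_mul_left,
      h.innerW_eq_zero n.succ_ne_self, sub_zero, sub_eq_zero] at h2
    exact h2
  have h3 : alphaCoef P n * innerW W (P n) (P n)
      = innerW W (P n) (P n) * (alphaCoef P n).conjTranspose := by
    rw [← h1, innerW_X_mul, ← h.weight.conjTranspose_innerW (X * P n), h1,
      Matrix.conjTranspose_mul, h.weight.conjTranspose_innerW]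
  calc Γ n * alphaCoef P n
      = Γ n * (alphaCoef P n * innerW W (P n) (P n)) * Γ n := by
        rw [mul_assoc, mul_assoc, h.innerW_self_mul, mul_one]
    _ = _ := by rw [h3, ← mul_assoc, h.mul_innerW_self, one_mul]

/-- The Christoffel–Darboux formula. -/
theorem X_sub_C_mul_reproducingKernel (h : IsOrthogonalSystem W P Γ) (n : ℕ) (z : ℂ) :
    (X - C (Matrix.scalar (Fin N) (starRingEnd ℂ z))) * reproducingKernel P Γ (n + 1) z
      = C ((matEval (P n) z).conjTranspose * Γ n) * P (n + 1)
        - C ((matEval (P (n + 1)) z).conjTranspose * Γ n) * P n := by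
  have hcomm : ∀ (A : CMat N) (F : (CMat N)[X]),
      (X - C (Matrix.scalar (Fin N) (starRingEnd ℂ z))) * (C A * F)
        = C A * (X * F) - C (starRingEnd ℂ z • A) * F := by
    intro A F
    rw [sub_mul, ← mul_assoc X, X_mul_C, mul_assoc, ← mul_assoc (C _) (C A), ← C_mul,
      Matrix.scalar_apply, ← Matrix.smul_one_eq_diagonal, smul_mul_assoc, one_mul]
  induction n with
  | zero =>
    have hz : starRingEnd ℂ z • ((matEval (P 0) z).conjTranspose * Γ 0)
        = (matEval (P 1) z).conjTranspose * Γ 0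
          + (matEval (P 0) z).conjTranspose * Γ 0 * alphaCoef P 0 := by
      have := congrArg (fun F => (matEval F z).conjTranspose * Γ 0) h.X_mul_zero
      simpa only [matEval_mul, matEval_add, matEval_C, matEval_X, smul_mul_assoc, one_mul,
        Matrix.conjTranspose_add, Matrix.conjTranspose_mul, Matrix.conjTranspose_smul, add_mul,
        mul_assoc, ← h.gamma_mul_alphaCoef] using! this
    rw [reproducingKernel, Finset.sum_range_one, hcomm, h.X_mul_zero, hz, C_add,
      C_mul (b := alphaCoef P 0)]
    simp only [mul_add, add_mul, mul_assoc, zero_add]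
    abel
  | succ n ih =>
    -- This is the adjoint of the recurrence at `z`. Commuting `α*` past `Γ` makes the `α` terms
    -- cancel against those of `X P_{n+1}`, and the rest telescopes with `ih`.
    have hz : starRingEnd ℂ z • ((matEval (P (n + 1)) z).conjTranspose * Γ (n + 1))
        = (matEval (P (n + 2)) z).conjTranspose * Γ (n + 1)
          + (matEval (P (n + 1)) z).conjTranspose * Γ (n + 1) * alphaCoef P (n + 1)
          + (matEval (P n) z).conjTranspose * Γ n := by
      have := congrArg (fun F => (matEval F z).conjTranspose * Γ (n + 1)) (h.X_mul_succ n)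
      simpa only [matEval_mul, matEval_add, matEval_C, matEval_X, smul_mul_assoc, one_mul,
        Matrix.conjTranspose_add, Matrix.conjTranspose_mul, Matrix.conjTranspose_smul, add_mul,
        mul_assoc, ← h.gamma_mul_alphaCoef, h.weight.conjTranspose_innerW, h.isHermitian_gamma,
        h.innerW_self_mul, mul_one] using! this
    have hΓ : (matEval (P (n + 1)) z).conjTranspose * Γ (n + 1)
        * (innerW W (P (n + 1)) (P (n + 1)) * Γ n)
        = (matEval (P (n + 1)) z).conjTranspose * Γ n := by
      rw [mul_assoc, ← mul_assoc (Γ (n + 1)), h.mul_innerW_self, one_mul]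
    rw [reproducingKernel, Finset.sum_range_succ, mul_add, ← reproducingKernel, ih, hcomm,
      h.X_mul_succ, hz, mul_add, mul_add, ← mul_assoc (C _) (C (_ * Γ n)), ← C_mul, hΓ,
      C_add, C_add, C_mul (b := alphaCoef P (n + 1))]
    simp only [add_mul, mul_assoc]
    abel

end IsOrthogonalSystem

/-! ### Divided differences at a scalar point. -/

section DividedDifference

variable {N : ℕ}

/-- The divided difference `(F(X) - F(z)) / (X - z)` of a matrix polynomial. -/
noncomputable def dividedDifference (z : ℂ) (F : (CMat N)[X]) : (CMat N)[X] :=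
  F /ₘ (X - C (Matrix.scalar (Fin N) z))

theorem C_matEval_add_mul_dividedDifference (z : ℂ) (F : (CMat N)[X]) :
    C (matEval F z) + (X - C (Matrix.scalar (Fin N) z)) * dividedDifference z F = F := by
  -- The matrix ring is trivial for `N = 0`, where the degree of `X - C _` is not `1`.
  nontriviality (CMat N)[X]
  have : Nontrivial (CMat N) := Polynomial.nontrivial_iff.1 inferInstance
  have h := modByMonic_add_div F (X - C (Matrix.scalar (Fin N) z))
  have hdeg := degree_modByMonic_lt F (monic_X_sub_C (Matrix.scalar (Fin N) z))
  rw [degree_X_sub_C] at hdeg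
  obtain ⟨A, hA⟩ : ∃ A, F %ₘ (X - C (Matrix.scalar (Fin N) z)) = C A :=
    ⟨_, eq_C_of_degree_le_zero (degree_le_iff_coeff_zero _ _ |>.2 fun k hk =>
      (degree_lt_iff_coeff_zero _ 1).1 (by exact_mod_cast hdeg) k (by exact_mod_cast hk))⟩
  rw [hA] at h
  have hz := congrArg (matEval · z) h
  simp only [matEval_add, matEval_C, matEval_mul, matEval_X_sub_C_scalar, sub_self, zero_smul,
    zero_mul, add_zero] at hz
  rw [← hz]; exact h

theorem dividedDifference_unique (z : ℂ) {F Q : (CMat N)[X]} {A : CMat N}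
    (h : C A + (X - C (Matrix.scalar (Fin N) z)) * Q = F) : dividedDifference z F = Q := by
  nontriviality (CMat N)[X]
  have : Nontrivial (CMat N) := Polynomial.nontrivial_iff.1 inferInstance
  exact (div_modByMonic_unique Q (C A) (monic_X_sub_C _) ⟨h, by
    rw [degree_X_sub_C]; exact degree_C_le.trans_lt (by norm_num)⟩).1

/-- Left coefficients pass through because `X - z` is central. -/
theorem dividedDifference_C_mul_sub (z : ℂ) (A B : CMat N) (F F' : (CMat N)[X]) :
    dividedDifference z (C A * F - C B * F')
      = C A * dividedDifference z F - C B * dividedDifference z F' := by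
  have hcomm : ∀ (A : CMat N) (Q : (CMat N)[X]), (X - C (Matrix.scalar (Fin N) z)) * (C A * Q)
      = C A * ((X - C (Matrix.scalar (Fin N) z)) * Q) := by
    intro A Q
    rw [← mul_assoc, ← mul_assoc, sub_mul, mul_sub, X_mul_C, ← C_mul, ← C_mul,
      (Matrix.scalar_commute z (Commute.all z) A).eq]
  refine dividedDifference_unique z (A := A * matEval F z - B * matEval F' z) ?_
  conv_rhs => rw [← C_matEval_add_mul_dividedDifference z F,
    ← C_matEval_add_mul_dividedDifference z F']
  rw [mul_sub, hcomm, hcomm, C_sub, C_mul, C_mul, mul_add, mul_add]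
  abel

theorem dividedDifference_X_sub_C_mul (z : ℂ) (F : (CMat N)[X]) :
    dividedDifference z ((X - C (Matrix.scalar (Fin N) z)) * F) = F :=
  mul_divByMonic_cancel_left F (monic_X_sub_C _)

theorem coeff_dividedDifference (z : ℂ) {F : (CMat N)[X]} {d : ℕ} (hF : F.natDegree ≤ d) (i j : ℕ)
    (hij : i + j = d) : (dividedDifference z F).coeff i
      = ∑ l ∈ Finset.range j, z ^ l • F.coeff (i + 1 + l) := by
  rw [dividedDifference, coeff_divByMonic_X_sub_C,
    Finset.sum_subset (s₂ := Finset.Ico (i + 1) (d + 1)), Finset.sum_Ico_eq_sum_range]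
  · refine Finset.sum_congr (by congr 1; omega) fun l _ => ?_
    rw [Nat.add_sub_cancel_left, ← map_pow, Matrix.scalar_apply, ← Matrix.smul_one_eq_diagonal,
      smul_mul_assoc, one_mul]
  · intro k hk
    simp only [Finset.mem_Icc, Finset.mem_Ico] at hk ⊢
    omega
  · intro k hk hk'
    simp only [Finset.mem_Icc, Finset.mem_Ico] at hk hk'
    rw [coeff_eq_zero_of_natDegree_lt (by omega), mul_zero]

theorem coeff_dividedDifference_eq_zero (z : ℂ) {F : (CMat N)[X]} {d i : ℕ} (hF : F.natDegree ≤ d)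
    (hi : d ≤ i) : (dividedDifference z F).coeff i = 0 := by
  rw [coeff_dividedDifference z (hF.trans hi) i 0 rfl, Finset.sum_range_zero]

end DividedDifference

/-! ### The `Δ_{j,n}` as coefficients of a divided difference. -/

section Delta

variable {N : ℕ} {P : ℕ → (CMat N)[X]} {G : (CMat N)[X]} {n m : ℕ}

/-- Reversing the polynomials turns coefficients counted from the top into an ordinary Cauchy
product. -/
theorem coeff_mul_eq_sum_aCoef (hP : (P n).natDegree ≤ n) (hG : G.natDegree ≤ m) {s : ℕ}
    (hs : s ≤ m) : (P n * G).coeff (n + m - s)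
      = ∑ i ∈ Finset.range (s + 1), aCoef P n ((n : ℤ) - (i : ℤ)) * G.coeff (m - s + i) := by
  rw [← revAt_le (show s ≤ n + m by omega), ← coeff_reflect, reflect_mul _ _ hP hG, coeff_mul,
    Finset.Nat.sum_antidiagonal_eq_sum_range_succ_mk]
  refine Finset.sum_congr rfl fun i hi => ?_
  have hi := Finset.mem_range.1 hi
  rw [coeff_reflect, coeff_reflect, revAt_le (show s - i ≤ m by omega),
    show m - (s - i) = m - s + i by omega]
  congr 1
  -- For `i > n` the reversal fixes `i`, where `P n` has coefficient zero, in agreement with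
  -- `a_{n,j} = 0` for `j < 0`.
  rcases le_or_gt i n with h | h
  · rw [revAt_le h, aCoef, if_pos (by omega)]
    congr 1; omega
  · rw [revAt_eq_self_of_lt h, aCoef, if_neg (by omega), coeff_eq_zero_of_natDegree_lt (by omega)]

theorem DeltaCoef_eq_sum (hP : (P n).natDegree ≤ n) (hG : G.natDegree ≤ m) {j : ℕ} (hj : j ≤ m)
    (z : ℂ) : DeltaCoef P G m j n z
      = ∑ l ∈ Finset.range (j + 1), z ^ l • (P n * G).coeff (n + m - (j - l)) := by
  have h : ∀ l ∈ Finset.range (j + 1), z ^ l • (P n * G).coeff (n + m - (j - l))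
      = ∑ i ∈ Finset.range (j - l + 1),
        z ^ l • (aCoef P n ((n : ℤ) - (i : ℤ)) * G.coeff (m - (j - l) + i)) := fun l _ => by
    rw [coeff_mul_eq_sum_aCoef hP hG (by omega), Finset.smul_sum]
  rw [Finset.sum_congr rfl h]
  simp only [DeltaCoef, PTrunc, Finset.sum_mul, smul_mul_assoc]
  rw [Finset.sum_sigma', Finset.sum_sigma']
  -- The terms are regrouped by the power `l = k - i` of `z`.
  refine Finset.sum_bij' (fun p _ => ⟨p.1 - p.2, p.2⟩) (fun p _ => ⟨p.1 + p.2, p.2⟩) ?_ ?_ ?_ ?_ ?_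
  all_goals
    rintro ⟨k, i⟩ hki
    simp only [Finset.mem_sigma, Finset.mem_range] at hki
  · simp only [Finset.mem_sigma, Finset.mem_range]; omega
  · simp only [Finset.mem_sigma, Finset.mem_range]; omega
  · simp only [Sigma.mk.injEq, heq_eq_eq, and_true]; omega
  · simp only [Sigma.mk.injEq, heq_eq_eq, and_true]; omega
  · simp only
    rw [show m - (j - (k - i)) + i = m - j + k by omega]

theorem DeltaCoef_eq_coeff_dividedDifference (hP : (P n).natDegree ≤ n) (hG : G.natDegree ≤ m)
    {i j : ℕ} (hj : j ≤ m) (hij : i + 1 + j = n + m) (z : ℂ) :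
    DeltaCoef P G m j n z = (dividedDifference z (P n * G)).coeff i := by
  rw [DeltaCoef_eq_sum hP hG hj, coeff_dividedDifference z
    (natDegree_mul_le.trans (add_le_add hP hG)) i (j + 1) (by omega)]
  refine Finset.sum_congr rfl fun l hl => ?_
  have hl := Finset.mem_range.1 hl
  congr 2; omega

theorem DeltaCoef_self_zero (hP : P 0 = 1) (hG : G.natDegree ≤ m) (z : ℂ) :
    DeltaCoef P G m m 0 z = matEval G z := by
  rw [DeltaCoef_eq_sum (by simp [hP]) hG le_rfl, hP]
  conv_rhs => rw [G.as_sum_range_C_mul_X_pow' (Nat.lt_succ_of_le hG)]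
  rw [matEval_sum]
  refine Finset.sum_congr rfl fun l hl => ?_
  have hl := Finset.mem_range.1 hl
  rw [one_mul, matEval_mul, matEval_C, matEval_X_pow, mul_smul_comm, mul_one]
  congr 2; omega

end Delta

/-! ### Ladder relations. -/

namespace IsOrthogonalSystem

variable {N : ℕ} {W : ℝ → CMat N} {P : ℕ → (CMat N)[X]} {Γ : ℕ → CMat N} {G : (CMat N)[X]}
  {m : ℕ}

theorem innerW_X_pow (h : IsOrthogonalSystem W P Γ) (n i : ℕ) :
    innerW W (P n) (X ^ i) = bCoef W P n i := by
  rw [bCoef]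
  split_ifs with hi
  · unfold innerW
    congr 1; ext1 x
    rw [matEval_X_pow, Matrix.conjTranspose_smul, Matrix.conjTranspose_one, mul_smul_comm, mul_one]
    simp
  · exact (h.monic n).2.2 _ ((degree_X_pow_le i).trans_lt (by exact_mod_cast not_le.1 hi))

theorem bCoef_eq_zero {n : ℕ} {k : ℤ} (hk : k < n) : bCoef W P n k = 0 :=
  if_neg (not_le.2 hk)

/-- Orthogonality leaves only the top coefficients: for `j ≥ M` the index `s - 1 - j` is below `n`.
Where the natural subtraction truncates, the integer index is negative and `b` vanishes. -/
theorem innerW_eq_sum_bCoef (h : IsOrthogonalSystem W P Γ) (n s M : ℕ) (hs : s ≤ n + M)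
    {F : (CMat N)[X]} (hF : ∀ i, s ≤ i → F.coeff i = 0) :
    innerW W (P n) F = ∑ j ∈ Finset.range M,
      bCoef W P n ((s : ℤ) - 1 - j) * (F.coeff (s - 1 - j)).conjTranspose := by
  have hsum : F = ∑ i ∈ Finset.range s, C (F.coeff i) * X ^ i := by
    ext1 k
    simp only [finsetSum_coeff, coeff_C_mul, coeff_X_pow, mul_ite, mul_one, mul_zero,
      Finset.sum_ite_eq, Finset.mem_range]
    split_ifs with hk
    · rfl
    · exact hF k (not_lt.1 hk)
  have h1 : innerW W (P n) F = ∑ j ∈ Finset.range s,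
      bCoef W P n ((s : ℤ) - 1 - j) * (F.coeff (s - 1 - j)).conjTranspose := by
    conv_lhs => rw [hsum]
    rw [h.weight.innerW_sum_right, ← Finset.sum_range_reflect]
    refine Finset.sum_congr rfl fun j hj => ?_
    have hj := Finset.mem_range.1 hj
    rw [h.weight.innerW_C_mul_right, h.innerW_X_pow]
    congr 2; omega
  rw [h1, Finset.sum_subset (Finset.range_mono (le_max_left s M)),
    Finset.sum_subset (Finset.range_mono (le_max_right s M))]
  all_goals
    intro j _ hj
    have hj := not_lt.1 (mt Finset.mem_range.2 hj)
    rw [bCoef_eq_zero (by omega), zero_mul]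

theorem P_zero (h : IsOrthogonalSystem W P Γ) : P 0 = 1 := by
  rw [eq_C_of_natDegree_le_zero (h.monic 0).1, (h.monic 0).2.1, C_1]

theorem derivative_add_mul_eq (h : IsOrthogonalSystem W P Γ)
    (hD : ∀ F Q : (CMat N)[X],
      innerW W (derivative F + F * G) Q = -innerW W F (derivative Q + Q * G)) (n : ℕ) (z : ℂ) :
    matEval (derivative (P (n + 1))) z + matEval (P (n + 1)) z * matEval G z
      = (innerW W (P (n + 1)) (dividedDifference (starRingEnd ℂ z) (P n * G))
          + innerW W (dividedDifference z (P (n + 1) * G)) (P n)) * Γ n * matEval (P (n + 1)) z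
        - (innerW W (P (n + 1)) (dividedDifference (starRingEnd ℂ z) (P (n + 1) * G))
          + innerW W (dividedDifference z (P (n + 1) * G)) (P (n + 1))) * Γ n
          * matEval (P n) z := by
  set K := reproducingKernel P Γ (n + 1) z with hK
  have hderiv : ∀ {F : (CMat N)[X]} {d : ℕ}, F.degree < (d : WithBot ℕ) →
      (derivative F).degree < (d : WithBot ℕ) := fun hF => degree_derivative_le.trans_lt hF
  have hCD := h.X_sub_C_mul_reproducingKernel n z
  -- `K G` is the divided difference at `z̄` of `(X - z̄) K G`, to which Christoffel–Darboux
  -- applies.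
  have hKG : K * G
      = C ((matEval (P n) z).conjTranspose * Γ n)
          * dividedDifference (starRingEnd ℂ z) (P (n + 1) * G)
        - C ((matEval (P (n + 1)) z).conjTranspose * Γ n)
          * dividedDifference (starRingEnd ℂ z) (P n * G) := by
    rw [← dividedDifference_C_mul_sub, ← mul_assoc, ← mul_assoc, ← sub_mul, ← hCD, mul_assoc,
      dividedDifference_X_sub_C_mul]
  have h1 : matEval (derivative (P (n + 1))) z = innerW W (derivative (P (n + 1))) K := by
    refine (h.innerW_reproducingKernel ?_ z).symm
    rw [degree_lt_iff_coeff_zero]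
    intro k hk
    rw [coeff_derivative, (h.monic (n + 1)).coeff_eq_zero (by omega), zero_mul]
  have h2 : innerW W (P (n + 1) * G) K = matEval (P (n + 1)) z * matEval G z
      + innerW W (dividedDifference z (P (n + 1) * G))
        ((X - C (Matrix.scalar (Fin N) (starRingEnd ℂ z))) * K) := by
    conv_lhs => rw [← C_matEval_add_mul_dividedDifference z (P (n + 1) * G)]
    rw [h.weight.innerW_add_left, innerW_X_sub_C_mul, h.innerW_reproducingKernel
      (degree_C_le.trans_lt (by exact_mod_cast n.succ_pos)), matEval_C, matEval_mul]
  have h3 : innerW W (derivative (P (n + 1))) K + innerW W (P (n + 1) * G) K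
      = -innerW W (P (n + 1)) (K * G) := by
    rw [← h.weight.innerW_add_left, hD, h.weight.innerW_add_right, (h.monic (n + 1)).2.2 _
      (hderiv (h.degree_reproducingKernel_lt (n + 1) z)), zero_add]
  rw [h1, ← add_sub_cancel_right (_ * matEval G z), ← h2, ← add_sub_assoc, h3, hKG, hCD]
  simp only [h.weight.innerW_sub_right, h.weight.innerW_C_mul_right, Matrix.conjTranspose_mul,
    Matrix.conjTranspose_conjTranspose, h.isHermitian_gamma, add_mul, mul_assoc]
  abel

theorem recurrence {κ : ℕ → CMat N} (h : IsOrthogonalSystem W P (gammaCoef κ)) (n : ℕ) (z : ℂ) :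
    z • matEval (P n) z
      = matEval (P (n + 1)) z + alphaCoef P n * matEval (P n) z
        + betaCoef κ n * matEval (P (n - 1)) z := by
  cases n with
  | zero =>
    have := congrArg (matEval · z) h.X_mul_zero
    simpa [matEval_mul, matEval_add, matEval_C, matEval_X, betaCoef] using this
  | succ n =>
    have := congrArg (matEval · z) (h.X_mul_succ n)
    rw [betaCoef, Matrix.inv_eq_left_inv (h.innerW_self_mul (n + 1))]
    simpa [matEval_mul, matEval_add, matEval_C, matEval_X] using this

theorem lowering {κ : ℕ → CMat N} (h : IsOrthogonalSystem W P (gammaCoef κ))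
    (hD : ∀ F Q : (CMat N)[X],
      innerW W (derivative F + F * G) Q = -innerW W F (derivative Q + Q * G))
    (hG : G.natDegree ≤ m) (n : ℕ) (z : ℂ) :
    matEval (derivative (P n)) z + matEval (P n) z * matEval G z
      = -calB W P κ G m n z * matEval (P n) z
        + matStar (calA W P κ G m n) z * betaCoef κ n * matEval (P (n - 1)) z := by
  cases n with
  | zero =>
    rw [calB, DeltaCoef_self_zero h.P_zero hG, h.P_zero, derivative_one, matEval_zero, matEval_one]
    simp [betaCoef]
  | succ n =>
    have hdeg : ∀ k, (P k * G).natDegree ≤ k + m := fun k =>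
      natDegree_mul_le.trans (add_le_add (h.monic k).1 hG)
    have hΔ : ∀ k j i, j ≤ m → i + 1 + j = k + m → ∀ w,
        DeltaCoef P G m j k w = (dividedDifference w (P k * G)).coeff i := fun k j i hj hij w =>
      DeltaCoef_eq_coeff_dividedDifference (h.monic k).1 hG hj hij w
    have e1 := h.innerW_eq_sum_bCoef (n + 1) (n + 1 + m) m le_rfl fun i hi =>
      coeff_dividedDifference_eq_zero (starRingEnd ℂ z) (hdeg (n + 1)) hi
    have e2 := h.innerW_eq_sum_bCoef (n + 1) (n + 1 + m) m le_rfl fun i hi =>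
      coeff_dividedDifference_eq_zero z (hdeg (n + 1)) hi
    -- Fewer terms would suffice here; `m + 1` matches the common range in `calB`, and the surplus
    -- ones vanish.
    have e3 := h.innerW_eq_sum_bCoef (n + 1) (n + m) (m + 1) (by omega) fun i hi =>
      coeff_dividedDifference_eq_zero (starRingEnd ℂ z) (hdeg n) hi
    have e4 := h.innerW_eq_sum_bCoef n (n + 1 + m) (m + 1) (by omega) fun i hi =>
      coeff_dividedDifference_eq_zero z (hdeg (n + 1)) hi
    have hA : matStar (calA W P κ G m (n + 1)) z
        = -((innerW W (P (n + 1)) (dividedDifference (starRingEnd ℂ z) (P (n + 1) * G))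
          + innerW W (dividedDifference z (P (n + 1) * G)) (P (n + 1)))
            * gammaCoef κ (n + 1)) := by
      rw [← h.weight.conjTranspose_innerW (P (n + 1)) (dividedDifference z _), e1, e2]
      simp only [matStar, calA, Matrix.conjTranspose_neg, Matrix.conjTranspose_mul,
        Matrix.conjTranspose_sum, Matrix.conjTranspose_add, Matrix.conjTranspose_conjTranspose,
        h.isHermitian_gamma, Complex.conj_conj, ← Finset.sum_add_distrib]
      congr 2
      refine Finset.sum_congr rfl fun j hj => ?_
      have hj := Finset.mem_range.1 hj
      rw [hΔ (n + 1) j (n + 1 + m - 1 - j) hj.le (by omega),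
        hΔ (n + 1) j (n + 1 + m - 1 - j) hj.le (by omega),
        show ((n + 1 + m : ℕ) : ℤ) - 1 - j = ((n + 1 : ℕ) : ℤ) + m - j - 1 by push_cast; ring]
      abel
    have hB : -calB W P κ G m (n + 1) z
        = (innerW W (P (n + 1)) (dividedDifference (starRingEnd ℂ z) (P n * G))
          + innerW W (dividedDifference z (P (n + 1) * G)) (P n)) * gammaCoef κ n := by
      rw [← h.weight.conjTranspose_innerW (P n) (dividedDifference z _), e3, e4]
      simp only [matStar, calB, neg_neg, Matrix.conjTranspose_mul,
        Matrix.conjTranspose_sum, Matrix.conjTranspose_conjTranspose, ← Finset.sum_add_distrib]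
      congr 1
      refine Finset.sum_congr rfl fun j hj => ?_
      have hj := Nat.lt_succ_iff.1 (Finset.mem_range.1 hj)
      rw [hΔ (n + 1) j (n + 1 + m - 1 - j) hj (by omega), add_comm,
        show ((n + 1 + m : ℕ) : ℤ) - 1 - j = ((n + 1 : ℕ) : ℤ) + m - j - 1 by push_cast; ring,
        show ((n + m : ℕ) : ℤ) - 1 - j = ((n + 1 : ℕ) : ℤ) + m - j - 2 by push_cast; ring]
      congr 1
      -- The second case is `n = 0`, `j = m`: `Δ` is then no coefficient of the divided difference,
      -- but it is multiplied by `b_{1,-1} = 0`.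
      rcases le_or_gt (j + 1) (n + m) with hjn | hjn
      · rw [hΔ n j (n + m - 1 - j) hj (by omega)]
      · rw [bCoef_eq_zero (by push_cast; omega), zero_mul, zero_mul]
    have hβ : gammaCoef κ (n + 1) * betaCoef κ (n + 1) = gammaCoef κ n := by
      rw [betaCoef, ← mul_assoc, Matrix.inv_eq_left_inv (h.innerW_self_mul (n + 1)),
        h.mul_innerW_self, one_mul]
    rw [h.derivative_add_mul_eq hD, hA, hB, neg_mul, mul_assoc _ _ (betaCoef κ (n + 1)), hβ,
      neg_mul, ← sub_eq_add_neg, Nat.add_sub_cancel]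

end IsOrthogonalSystem

theorem mainTheorem4 (N m : ℕ) (W T : ℝ → CMat N) (G : (CMat N)[X])
    (hpos : ∀ x : ℝ, (W x).PosDef)
    (hmom : ∀ (k : ℕ) (i j : Fin N), Integrable (fun x : ℝ => (x : ℂ) ^ k * W x i j) volume)
    (hWT : ∀ x : ℝ, W x = T x * (T x).conjTranspose)
    (hT : ∀ (x : ℝ) (i j : Fin N),
      HasDerivAt (fun t : ℝ => T t i j) ((matEval G (x : ℂ) * T x) i j) x)
    (hG : G.natDegree ≤ m) :
    (∃! P : ℕ → (CMat N)[X], IsMonicMOPRL W P) ∧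
    ∀ P : ℕ → (CMat N)[X], IsMonicMOPRL W P →
      (∃ κ : ℕ → CMat N, IsNormalization W P κ) ∧
      ∀ κ : ℕ → CMat N, IsNormalization W P κ → ∀ (n : ℕ) (z : ℂ),
        -- `α_n`, `β_n` are the coefficients of the three-term recurrence (`β_0 P_{-1} = 0`)
        z • matEval (P n) z
            = matEval (P (n + 1)) z + alphaCoef P n * matEval (P n) z
              + betaCoef κ n * matEval (P (n - 1)) z ∧
        -- lowering relation
        matEval (derivative (P n)) z + matEval (P n) z * matEval G z
            = -calB W P κ G m n z * matEval (P n) z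
              + matStar (calA W P κ G m n) z * betaCoef κ n * matEval (P (n - 1)) z ∧
        -- raising relation
        matEval (derivative (P n)) z + matEval (P n) z * matEval G z
            = (matStar (calA W P κ G m n) z * (z • (1 : CMat N) - alphaCoef P n)
                - calB W P κ G m n z) * matEval (P n) z
              - matStar (calA W P κ G m n) z * matEval (P (n + 1)) z := by
  have hW : IsMomentWeight W := ⟨fun x => (hpos x).isHermitian, hmom⟩
  have hdef : ∀ (p : (CMat N)[X]) (n : ℕ), p.coeff n = 1 → (innerW W p p).PosDef :=
    fun _ _ hp => posDef_innerW_self hW hpos hWT hT hp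
  refine ⟨existsUnique_isMonicMOPRL hW hdef, fun P hP =>
    ⟨exists_isNormalization hW hdef hP, fun κ hκ n z => ?_⟩⟩
  have h : IsOrthogonalSystem W P (gammaCoef κ) :=
    ⟨hW, hP, hκ.innerW_self_mul_gammaCoef hW⟩
  have hrec := h.recurrence n z
  have hlow := h.lowering (innerW_derivative_add hW hWT hT) hG n z
  refine ⟨hrec, hlow, ?_⟩
  -- The recurrence eliminates `P_{n-1}`; for `n = 0` the truncated index is harmless since `β_0 =
  -- 0`.
  have hβ : betaCoef κ n * matEval (P (n - 1)) z
      = (z • (1 : CMat N) - alphaCoef P n) * matEval (P n) z - matEval (P (n + 1)) z := by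
    rw [sub_mul, smul_mul_assoc, one_mul, hrec]; abel
  rw [hlow, mul_assoc, hβ, mul_sub, ← mul_assoc, sub_mul _ (calB W P κ G m n z), neg_mul]
  abel
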